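/- A \emph{tape graph} $(G,S)$ consists of an infinite group $G$ and a finite generating set $S\subset G$ that is closed under inverses, viewed as the Cayley graph of $G$ with an edge coloured $g$ from $x$ to $xg$ for all $x\in G$, $g\in S$. An infinite sequence $s=(s_0,s_1,s_2,\dots)$ of elements of the finite set $S$ is \emph{computable} if some Turing machine produces (a code for) $s_n$ on input $n$. The sequence $s$ traces the path with vertices $p_0=e$ and $p_k=s_0s_1\cdots s_{k-1}$ for $k\ge 1$; this path is \emph{self-intersecting} if $p_i=p_j$ for some $i<j$. An \emph{inescapable group} is a tape graph $(G,S)$ such that every infinite computable sequence of elements of $S$ traces a self-intersecting path. \textbf{Theorem.} There exists an inescapable group: there are an infinite group $G$ and a finite generating set $S$ of $G$, closed under inverses, such that every infinite computable sequence of elements of $S$ traces a self-intersecting path in the Cayley graph of $G$ with respect to $S$. -/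

import Mathlib

/-- A tape graph `(G, S)`: the group `G` is infinite and `S` is a finite generating set of `G`
that is closed under inverses. Its vertices are the elements of `G`, and from every vertex `x`
there is exactly one outgoing edge of each colour `g ∈ S`, which leads to `x * g`. -/
structure TapeGraph (G : Type*) [Group G] where
  gens : Set G
  infinite : Infinite G
  finite_gens : gens.Finite
  inv_mem : ∀ g ∈ gens, g⁻¹ ∈ gens
  closure_gens : Subgroup.closure gens = ⊤

/-- An infinite sequence `s` of symbols from a finite alphabet `A` is computable if, after the
symbols have been numbered `0, …, n - 1`, the function sending `k` to the number of the `k`-th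
symbol is computable. (Any two numberings differ by a permutation of a finite set, so the notion
does not depend on the numbering.) -/
def IsComputableSeq {A : Type*} (s : ℕ → A) : Prop :=
  ∃ (n : ℕ) (e : A ≃ Fin n), Computable fun k : ℕ => e (s k)

namespace TapeGraph

/-- There is an edge of colour `g` from `x` to `y` in the Cayley graph. -/
def Edge {G : Type*} [Group G] (T : TapeGraph G) (g : T.gens) (x y : G) : Prop :=
  y = x * (g : G)

/-- The infinite path in the Cayley graph that starts at the identity and whose `k`-th step
follows the edge of colour `s k`: its `k`-th vertex is `s 0 * s 1 * ⋯ * s (k - 1)`. -/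
def path {G : Type*} [Group G] (T : TapeGraph G) (s : ℕ → T.gens) : ℕ → G
  | 0 => 1
  | k + 1 => path T s k * (s k : G)

theorem edge_path {G : Type*} [Group G] (T : TapeGraph G) (s : ℕ → T.gens) (k : ℕ) :
    T.Edge (s k) (T.path s k) (T.path s (k + 1)) := rfl

/-- The path traced by `s` visits some vertex at two different times. -/
def SelfIntersecting {G : Type*} [Group G] (T : TapeGraph G) (s : ℕ → T.gens) : Prop :=
  ∃ i j : ℕ, i < j ∧ T.path s i = T.path s j

/-- A tape graph is inescapable if every infinite computable sequence of generators traces a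
self-intersecting path. -/
def IsInescapable {G : Type*} [Group G] (T : TapeGraph G) : Prop :=
  ∀ s : ℕ → T.gens, IsComputableSeq s → T.SelfIntersecting s

end TapeGraph

/-! There are only countably many computable sequences, so each can be defeated by a relator of its
own. Over `ZMod 2` in six variables, read the `k`-th sequence as a product of factors `1 + x i`. By
pigeonhole modulo words of length at least `k + 2`, two prefixes differ by an element of degree at
least `k + 2` (`exists_prefixProd_sub_mem`). Impose these differences and the squares of the
variables as relators: the `1 + x i` become involutions, and every computable sequence of them
revisits a vertex. The relators are sparse enough for `golod_shafarevich` to force truncations of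
unbounded dimension (`le_truncDim`). The group generated by the involutions spans each truncation,
so it is infinite (`infinite_involutionGroup`). -/

namespace GolodShafarevich

open MonoidAlgebra

variable {K X : Type*} [Field K]

/-! ### Free algebra: length filtration and right derivatives -/

/-- The variable `x i` of the free algebra, realised as the monoid algebra of words. -/
noncomputable def gen (K : Type*) {X : Type*} [Field K] (i : X) : MonoidAlgebra K (FreeMonoid X) :=
  of K _ (FreeMonoid.of i)

/-- The span of the words of length at least `n`. -/
noncomputable def wordFiltration (K X : Type*) [Field K] (n : ℕ) :
    Submodule K (MonoidAlgebra K (FreeMonoid X)) :=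
  Submodule.span K (of K _ '' {w : FreeMonoid X | n ≤ w.length})

/-- The augmentation, sending every variable to `0`. -/
noncomputable def augmentation (K X : Type*) [Field K] :
    MonoidAlgebra K (FreeMonoid X) →ₐ[K] K :=
  MonoidAlgebra.lift K K (FreeMonoid X) (FreeMonoid.lift fun _ => 0)

/-- The right derivative: the coefficient of `x i` when an element with zero constant term is
written as a left linear combination of the variables. -/
noncomputable def lastCoeff (K : Type*) {X : Type*} [Field K] [DecidableEq X] (i : X) :
    MonoidAlgebra K (FreeMonoid X) →ₗ[K] MonoidAlgebra K (FreeMonoid X) :=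
  (MonoidAlgebra.basis (FreeMonoid X) K).constr K fun w =>
    if w.toList.getLast? = some i then of K _ (FreeMonoid.ofList w.toList.dropLast) else 0

theorem word_eq_one_or_mul_of (w : FreeMonoid X) :
    w = 1 ∨ ∃ v i, w = v * FreeMonoid.of i := by
  rcases List.eq_nil_or_concat w.toList with h | ⟨v, i, h⟩
  · exact Or.inl h
  · exact Or.inr ⟨FreeMonoid.ofList v, i, h.trans List.concat_eq_append⟩

theorem word_induction {p : FreeMonoid X → Prop} (one : p 1)
    (mul_of : ∀ w i, p w → p (w * FreeMonoid.of i)) (w : FreeMonoid X) : p w :=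
  List.reverseRecOn (motive := p) w one mul_of

@[simp] theorem augmentation_gen (i : X) : augmentation K X (gen K i) = 0 := by
  simp [augmentation, gen]

section Derivative

variable [DecidableEq X]

theorem lastCoeff_of (i : X) (w : FreeMonoid X) :
    lastCoeff K i (of K _ w) =
      if w.toList.getLast? = some i then of K _ (FreeMonoid.ofList w.toList.dropLast) else 0 := by
  have : of K (FreeMonoid X) w = MonoidAlgebra.basis (FreeMonoid X) K w := rfl
  rw [this, lastCoeff, Module.Basis.constr_basis]

@[simp] theorem lastCoeff_one (i : X) : lastCoeff K i 1 = 0 := by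
  rw [← map_one (of K (FreeMonoid X)), lastCoeff_of]
  simp

theorem lastCoeff_of_mul_of (i j : X) (w : FreeMonoid X) :
    lastCoeff K i (of K _ (w * FreeMonoid.of j)) = if j = i then of K _ w else 0 := by
  rw [lastCoeff_of]
  simp

theorem lastCoeff_mul_gen (i j : X) (a : MonoidAlgebra K (FreeMonoid X)) :
    lastCoeff K i (a * gen K j) = if j = i then a else 0 := by
  induction a using MonoidAlgebra.induction_on with
  | of w => rw [gen, ← map_mul, lastCoeff_of_mul_of]
  | add a b ha hb => rw [add_mul, map_add, ha, hb]; split_ifs <;> simp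
  | smul c a ha => rw [smul_mul_assoc, map_smul, ha]; split_ifs <;> simp

/-- Leibniz rule: write `b` as its constant term plus a left combination of the variables, and
multiply by `a`. -/
theorem lastCoeff_mul (i : X) (a b : MonoidAlgebra K (FreeMonoid X)) :
    lastCoeff K i (a * b) = a * lastCoeff K i b + augmentation K X b • lastCoeff K i a := by
  induction b using MonoidAlgebra.induction_on with
  | of w =>
    rcases word_eq_one_or_mul_of w with rfl | ⟨v, j, rfl⟩
    · simp only [map_one, mul_one, lastCoeff_one, mul_zero, zero_add, one_smul]
    · have h : of K _ (v * FreeMonoid.of j) = of K _ v * gen K j := by rw [gen, map_mul]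
      rw [h, ← mul_assoc, lastCoeff_mul_gen, lastCoeff_mul_gen, map_mul, augmentation_gen]
      split_ifs <;> simp
  | add b c hb hc => rw [mul_add, map_add, map_add, map_add, hb, hc, mul_add, add_smul]; abel
  | smul c b hb =>
    rw [mul_smul_comm, map_smul, map_smul, map_smul, hb, smul_add, mul_smul_comm, smul_smul,
      smul_eq_mul]

theorem lastCoeff_mem (i : X) {n : ℕ} {a : MonoidAlgebra K (FreeMonoid X)}
    (ha : a ∈ wordFiltration K X (n + 1)) : lastCoeff K i a ∈ wordFiltration K X n := by
  have : wordFiltration K X (n + 1) ≤ (wordFiltration K X n).comap (lastCoeff K i) := by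
    rw [wordFiltration, Submodule.span_le]
    rintro _ ⟨w, hw, rfl⟩
    rcases word_eq_one_or_mul_of w with rfl | ⟨v, j, rfl⟩
    · simp at hw
    · rw [SetLike.mem_coe, Submodule.mem_comap, lastCoeff_of_mul_of]
      split_ifs
      · refine Submodule.subset_span ⟨v, ?_, rfl⟩
        simpa using hw
      · exact zero_mem _
  exact this ha

end Derivative

theorem wordFiltration_zero : wordFiltration K X 0 = ⊤ := by
  refine eq_top_iff.2 fun a _ => ?_
  induction a using MonoidAlgebra.induction_on with
  | of w => exact Submodule.subset_span ⟨w, Nat.zero_le _, rfl⟩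
  | add a b ha hb => exact add_mem (ha trivial) (hb trivial)
  | smul c a ha => exact Submodule.smul_mem _ c (ha trivial)

theorem wordFiltration_antitone : Antitone (wordFiltration K X) := fun _ _ h =>
  Submodule.span_mono (Set.image_mono fun _ hw => le_trans h hw)

theorem mul_mem_wordFiltration {m n : ℕ} {a b : MonoidAlgebra K (FreeMonoid X)}
    (ha : a ∈ wordFiltration K X m) (hb : b ∈ wordFiltration K X n) :
    a * b ∈ wordFiltration K X (m + n) := by
  have h := Submodule.mul_mem_mul ha hb
  rw [wordFiltration, wordFiltration, Submodule.span_mul_span] at h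
  refine Submodule.span_mono ?_ h
  rintro _ ⟨_, ⟨v, hv, rfl⟩, _, ⟨w, hw, rfl⟩, rfl⟩
  refine ⟨v * w, ?_, map_mul _ _ _⟩
  simpa using add_le_add hv hw

theorem gen_mem_wordFiltration (i : X) : gen K i ∈ wordFiltration K X 1 :=
  Submodule.subset_span ⟨FreeMonoid.of i, by simp, rfl⟩

theorem augmentation_eq_zero {a : MonoidAlgebra K (FreeMonoid X)}
    (ha : a ∈ wordFiltration K X 1) : augmentation K X a = 0 := by
  have : wordFiltration K X 1 ≤ LinearMap.ker (augmentation K X).toLinearMap := by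
    rw [wordFiltration, Submodule.span_le]
    rintro _ ⟨w, hw, rfl⟩
    rcases word_eq_one_or_mul_of w with rfl | ⟨v, j, rfl⟩
    · simp at hw
    · have h : of K _ (v * FreeMonoid.of j) = of K _ v * gen K j := by rw [gen, map_mul]
      simp only [SetLike.mem_coe, LinearMap.mem_ker, AlgHom.toLinearMap_apply]
      rw [h, map_mul, augmentation_gen, mul_zero]
  exact this ha

theorem finite_quotient_wordFiltration [Finite X] (n : ℕ) :
    Module.Finite K (MonoidAlgebra K (FreeMonoid X) ⧸ wordFiltration K X n) := by
  have hfin : {w : FreeMonoid X | w.length < n}.Finite := List.finite_length_lt X n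
  refine ⟨Submodule.fg_def.2 ⟨(wordFiltration K X n).mkQ ∘ of K _ '' {w | w.length < n},
    hfin.image _, eq_top_iff.2 ?_⟩⟩
  rintro x -
  obtain ⟨a, rfl⟩ := Submodule.mkQ_surjective _ x
  induction a using MonoidAlgebra.induction_on with
  | of w =>
    rcases lt_or_ge w.length n with h | h
    · exact Submodule.subset_span ⟨w, h, rfl⟩
    · have : (wordFiltration K X n).mkQ (of K _ w) = 0 := by
        rw [← LinearMap.mem_ker, Submodule.ker_mkQ]
        exact Submodule.subset_span ⟨w, h, rfl⟩
      rw [this]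
      exact zero_mem _
  | add a b ha hb => rw [map_add]; exact add_mem ha hb
  | smul c a ha => rw [map_smul]; exact Submodule.smul_mem _ c ha

/-! ### Golod–Shafarevich inequality for truncations -/

/-- The two-sided ideal generated by the relators `r`, as a subspace. -/
noncomputable def relatorSpan {ι : Type*} (r : ι → MonoidAlgebra K (FreeMonoid X)) :
    Submodule K (MonoidAlgebra K (FreeMonoid X)) :=
  Submodule.span K {c | ∃ a k b, c = a * r k * b}

/-- The sum of the ideal generated by the relators and the span of the words of length at least
`n`. -/
noncomputable def truncatedIdeal {ι : Type*} (r : ι → MonoidAlgebra K (FreeMonoid X)) (n : ℕ) :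
    Submodule K (MonoidAlgebra K (FreeMonoid X)) :=
  relatorSpan r ⊔ wordFiltration K X n

/-- The dimension of the truncation in degree `n` of the algebra with relators `r`. -/
noncomputable def truncDim {ι : Type*} (r : ι → MonoidAlgebra K (FreeMonoid X)) (n : ℕ) : ℕ :=
  Module.finrank K (MonoidAlgebra K (FreeMonoid X) ⧸ truncatedIdeal r n)

section Relators

variable {ι : Type*} {r : ι → MonoidAlgebra K (FreeMonoid X)}

theorem finite_quotient_truncatedIdeal [Finite X] (n : ℕ) :
    Module.Finite K (MonoidAlgebra K (FreeMonoid X) ⧸ truncatedIdeal r n) := by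
  have := finite_quotient_wordFiltration (K := K) (X := X) n
  exact Module.Finite.of_surjective
    (Submodule.factor (le_sup_right : wordFiltration K X n ≤ truncatedIdeal r n))
    (Submodule.factor_surjective _)

theorem mul_relator_mul_mem (n : ℕ) (a : MonoidAlgebra K (FreeMonoid X)) (k : ι)
    (b : MonoidAlgebra K (FreeMonoid X)) : a * r k * b ∈ truncatedIdeal r n :=
  Submodule.mem_sup_left (Submodule.subset_span ⟨a, k, b, rfl⟩)

theorem mkQ_eq_zero {n : ℕ} {a : MonoidAlgebra K (FreeMonoid X)} :
    (truncatedIdeal r n).mkQ a = 0 ↔ a ∈ truncatedIdeal r n := by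
  rw [← LinearMap.mem_ker, Submodule.ker_mkQ]

theorem one_notMem_truncatedIdeal (hr : ∀ k, r k ∈ wordFiltration K X 1) (n : ℕ) :
    1 ∉ truncatedIdeal r (n + 1) := by
  intro h
  have hle : truncatedIdeal r (n + 1) ≤ LinearMap.ker (augmentation K X).toLinearMap := by
    refine sup_le ?_ ?_
    · rw [relatorSpan, Submodule.span_le]
      rintro _ ⟨a, k, c, rfl⟩
      simp [augmentation_eq_zero (hr k)]
    · exact fun a ha => augmentation_eq_zero (wordFiltration_antitone (by omega) ha)
  simpa using hle h

variable [DecidableEq X]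

/-- The coefficients of the variables, modulo the truncated ideal. -/
noncomputable def coeffMap (r : ι → MonoidAlgebra K (FreeMonoid X)) (n : ℕ) :
    MonoidAlgebra K (FreeMonoid X) →ₗ[K] X → MonoidAlgebra K (FreeMonoid X) ⧸ truncatedIdeal r n :=
  LinearMap.pi fun i => (truncatedIdeal r n).mkQ ∘ₗ lastCoeff K i

theorem coeffMap_apply (n : ℕ) (a : MonoidAlgebra K (FreeMonoid X)) (i : X) :
    coeffMap r n a i = (truncatedIdeal r n).mkQ (lastCoeff K i a) := rfl

theorem coeffMap_eq_zero {n : ℕ} {a : MonoidAlgebra K (FreeMonoid X)}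
    (ha : a ∈ wordFiltration K X (n + 1)) : coeffMap r n a = 0 := by
  ext i
  exact mkQ_eq_zero.2 (Submodule.mem_sup_right (lastCoeff_mem i ha))

theorem coeffMap_surjective [Fintype X] (n : ℕ) : Function.Surjective (coeffMap r n) := by
  intro f
  choose a ha using fun i => Submodule.mkQ_surjective _ (f i)
  refine ⟨∑ j, a j * gen K j, ?_⟩
  ext i
  rw [coeffMap_apply, map_sum]
  simp only [lastCoeff_mul_gen]
  simp [← ha]

/-- The other Leibniz term, `a * r k * lastCoeff K i b`, lies in the ideal. Hence only left
multiples of relators contribute. -/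
theorem coeffMap_mul_relator_mul (n : ℕ) (a : MonoidAlgebra K (FreeMonoid X)) (k : ι)
    (b : MonoidAlgebra K (FreeMonoid X)) :
    coeffMap r n (a * r k * b) = augmentation K X b • coeffMap r n (a * r k) := by
  ext i
  rw [Pi.smul_apply, coeffMap_apply, coeffMap_apply, lastCoeff_mul, map_add,
    mkQ_eq_zero.2 (mul_relator_mul_mem n a k _), zero_add, map_smul]

/-- The map sending `b` to the coefficients of the variables in `b * r k`. -/
noncomputable def relatorMap (r : ι → MonoidAlgebra K (FreeMonoid X)) (n : ℕ) (k : ι) :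
    MonoidAlgebra K (FreeMonoid X) →ₗ[K] X → MonoidAlgebra K (FreeMonoid X) ⧸ truncatedIdeal r n :=
  coeffMap r n ∘ₗ LinearMap.mulRight K (r k)

theorem finrank_range_relatorMap_le [Finite X] {d : ℕ} (n : ℕ) (k : ι)
    (hr : ∀ k, r k ∈ wordFiltration K X 1) (hd : r k ∈ wordFiltration K X d) :
    Module.finrank K (LinearMap.range (relatorMap r n k)) ≤ truncDim r (n + 1 - d) := by
  -- An ideal element times `r k` dies because `r k` has zero constant term; a word of length at
  -- least `n + 1 - d` times `r k` has degree at least `n + 1`.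
  have hker : truncatedIdeal r (n + 1 - d) ≤ LinearMap.ker (relatorMap r n k) := by
    refine sup_le ?_ fun a ha => ?_
    · rw [relatorSpan, Submodule.span_le]
      rintro _ ⟨a, l, b, rfl⟩
      rw [SetLike.mem_coe, LinearMap.mem_ker, relatorMap, LinearMap.comp_apply,
        LinearMap.mulRight_apply, mul_assoc (a * r l), coeffMap_mul_relator_mul, map_mul,
        augmentation_eq_zero (hr k), mul_zero, zero_smul]
    · rw [LinearMap.mem_ker, relatorMap, LinearMap.comp_apply, LinearMap.mulRight_apply]
      exact coeffMap_eq_zero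
        (wordFiltration_antitone (by omega) (mul_mem_wordFiltration ha hd))
  have := finite_quotient_truncatedIdeal (r := r) (n + 1 - d)
  rw [← Submodule.range_liftQ _ _ hker]
  exact LinearMap.finrank_range_le _

theorem map_coeffMap_truncatedIdeal_le (n : ℕ) (F : Finset ι)
    (hF : ∀ k ∉ F, r k ∈ wordFiltration K X (n + 1)) :
    (truncatedIdeal r (n + 1)).map (coeffMap r n) ≤
      F.sup fun k => LinearMap.range (relatorMap r n k) := by
  rw [Submodule.map_le_iff_le_comap]
  refine sup_le ?_ fun a ha => ?_
  · rw [relatorSpan, Submodule.span_le]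
    rintro _ ⟨a, k, b, rfl⟩
    rw [SetLike.mem_coe, Submodule.mem_comap, coeffMap_mul_relator_mul]
    refine Submodule.smul_mem _ _ ?_
    by_cases hk : k ∈ F
    · exact Finset.le_sup (f := fun k => LinearMap.range (relatorMap r n k)) hk ⟨a, rfl⟩
    · have h : a * r k ∈ wordFiltration K X (0 + (n + 1)) :=
        mul_mem_wordFiltration (wordFiltration_zero (K := K) (X := X) ▸ trivial) (hF k hk)
      rw [zero_add] at h
      rw [coeffMap_eq_zero h]
      exact zero_mem _
  · rw [Submodule.mem_comap, coeffMap_eq_zero ha]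
    exact zero_mem _

theorem finrank_finset_sup_le {V : Type*} [AddCommGroup V] [Module K V] [Module.Finite K V]
    (F : Finset ι) (W : ι → Submodule K V) :
    Module.finrank K (F.sup W : Submodule K V) ≤ ∑ k ∈ F, Module.finrank K (W k) := by
  classical
  induction F using Finset.induction_on with
  | empty => simp
  | insert k F hk ih =>
    rw [Finset.sup_insert, Finset.sum_insert hk]
    exact (Submodule.finrank_add_le_finrank_add_finrank _ _).trans (by omega)

/-- The Golod–Shafarevich inequality for truncations. -/
theorem golod_shafarevich [Fintype X] (deg : ι → ℕ) (hdeg : ∀ k, 1 ≤ deg k)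
    (hr : ∀ k, r k ∈ wordFiltration K X (deg k)) (n : ℕ) (F : Finset ι)
    (hF : ∀ k ∉ F, n + 1 ≤ deg k) :
    1 + Fintype.card X * truncDim r n ≤
      truncDim r (n + 1) + ∑ k ∈ F, truncDim r (n + 1 - deg k) := by
  have hr1 : ∀ k, r k ∈ wordFiltration K X 1 := fun k => wordFiltration_antitone (hdeg k) (hr k)
  have := finite_quotient_truncatedIdeal (r := r) n
  have := finite_quotient_truncatedIdeal (r := r) (n + 1)
  set W := (truncatedIdeal r (n + 1)).map (coeffMap r n) with hW
  have hWle : Module.finrank K W ≤ ∑ k ∈ F, truncDim r (n + 1 - deg k) :=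
    (Submodule.finrank_mono (map_coeffMap_truncatedIdeal_le n F
      fun k hk => wordFiltration_antitone (hF k hk) (hr k))).trans
      ((finrank_finset_sup_le F _).trans
        (Finset.sum_le_sum fun k _ => finrank_range_relatorMap_le n k hr1 (hr k)))
  -- Surjectivity of `f` gives `truncDim r (n + 1) = card X * truncDim r n - dim W + dim ker f`; the
  -- class of `1` in the kernel supplies the summand 1.
  let f := Submodule.mapQ (truncatedIdeal r (n + 1)) W (coeffMap r n)
    (Submodule.map_le_iff_le_comap.1 le_rfl)
  have hf : LinearMap.range f = ⊤ := by
    rw [LinearMap.range_eq_top]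
    intro y
    obtain ⟨y, rfl⟩ := Submodule.mkQ_surjective _ y
    obtain ⟨a, rfl⟩ := coeffMap_surjective n y
    exact ⟨(truncatedIdeal r (n + 1)).mkQ a, rfl⟩
  have hker : 1 ≤ Module.finrank K (LinearMap.ker f) := by
    rw [Submodule.one_le_finrank_iff, Submodule.ne_bot_iff]
    refine ⟨(truncatedIdeal r (n + 1)).mkQ 1, ?_,
      fun h => one_notMem_truncatedIdeal hr1 n (mkQ_eq_zero.1 h)⟩
    have h1 : coeffMap r n 1 = 0 := by
      ext i
      rw [coeffMap_apply, lastCoeff_one, map_zero, Pi.zero_apply]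
    change W.mkQ (coeffMap r n 1) = 0
    rw [h1, map_zero]
  have h2 := LinearMap.finrank_range_add_finrank_ker f
  rw [hf, finrank_top] at h2
  have h3 := Submodule.finrank_quotient_add_finrank W
  rw [Module.finrank_pi_fintype] at h3
  simp only [Finset.sum_const, Finset.card_univ, smul_eq_mul] at h3
  unfold truncDim at hWle ⊢
  omega

end Relators

/-! ### Prefix products and growth of the truncations -/

/-- The free algebra in six variables over the field with two elements. -/
abbrev FreeAlg : Type := MonoidAlgebra (ZMod 2) (FreeMonoid (Fin 6))

/-- The product of the elements `1 + x (s j)` for `j < k`. -/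
noncomputable def prefixProd (s : ℕ → Fin 6) (k : ℕ) : FreeAlg :=
  ((List.range k).map fun j => 1 + gen (ZMod 2) (s j)).prod

theorem prefixProd_succ (s : ℕ → Fin 6) (k : ℕ) :
    prefixProd s (k + 1) = prefixProd s k * (1 + gen (ZMod 2) (s k)) := by
  simp [prefixProd, List.range_succ]

theorem exists_prefixProd_sub_mem (s : ℕ → Fin 6) (n : ℕ) :
    ∃ i j, i < j ∧ prefixProd s j - prefixProd s i ∈ wordFiltration (ZMod 2) (Fin 6) n := by
  have := finite_quotient_wordFiltration (K := ZMod 2) (X := Fin 6) n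
  have : Finite (FreeAlg ⧸ wordFiltration (ZMod 2) (Fin 6) n) := Module.finite_of_finite (ZMod 2)
  obtain ⟨i, j, hij, h⟩ := Finite.exists_ne_map_eq_of_infinite
    fun k => (wordFiltration (ZMod 2) (Fin 6) n).mkQ (prefixProd s k)
  rcases lt_or_gt_of_ne hij with hlt | hlt
  · exact ⟨i, j, hlt, (Submodule.Quotient.eq _).1 h.symm⟩
  · exact ⟨j, i, hlt, (Submodule.Quotient.eq _).1 h⟩

/-- The degrees of the relators: the squares of the variables, then one relator for each degree
at least two. -/
def relatorDeg : Fin 6 ⊕ ℕ → ℕ := Sum.elim (fun _ => 2) fun k => k + 2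

theorem le_truncDim {r : Fin 6 ⊕ ℕ → FreeAlg}
    (hr : ∀ k, r k ∈ wordFiltration (ZMod 2) (Fin 6) (relatorDeg k)) (n : ℕ) :
    n ≤ truncDim r n := by
  have key : ∀ n, 1 + 6 * truncDim r n ≤ truncDim r (n + 1) +
      (6 * truncDim r (n - 1) + ∑ k ∈ Finset.range n, truncDim r (n - 1 - k)) := by
    intro n
    have h := golod_shafarevich relatorDeg (by rintro (_ | _) <;> simp [relatorDeg]) hr n
      (Finset.univ.disjSum (Finset.range n)) (by
        rintro (i | k) hk
        · simp at hk
        · simp only [Finset.inr_mem_disjSum, Finset.mem_range, not_lt] at hk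
          simp only [relatorDeg, Sum.elim_inr]
          omega)
    rw [Finset.sum_disjSum] at h
    simp only [relatorDeg, Sum.elim_inl, Sum.elim_inr, Finset.sum_const, Finset.card_univ,
      Fintype.card_fin, smul_eq_mul, Nat.reduceSubDiff] at h
    convert h using 4 with k
    rw [Nat.sub_sub, Nat.add_comm 1 k]
  have hzero : truncDim r 0 = 0 := by
    have htop : truncatedIdeal r 0 = ⊤ := by
      rw [truncatedIdeal, wordFiltration_zero, sup_top_eq]
    have : Subsingleton (FreeAlg ⧸ truncatedIdeal r 0) :=
      Submodule.Quotient.subsingleton_iff.2 htop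
    exact Module.finrank_zero_of_subsingleton
  -- Write `d n` for `truncDim r n`. By induction both `6 * d n` and the sum up to `d n` are
  -- controlled: they are at most `3 * d (n + 1)` and `d (n + 1)`. Six variables leave the factor 6
  -- - 3 - 1 = 2.
  have step : ∀ n, 1 + 2 * truncDim r n ≤ truncDim r (n + 1) ∧
      ∑ k ∈ Finset.range n, truncDim r k ≤ truncDim r n := by
    intro n
    induction n with
    | zero => have := key 0; simp_all
    | succ n ih =>
      have hsum : ∑ k ∈ Finset.range (n + 1), truncDim r k ≤ truncDim r (n + 1) := by
        rw [Finset.sum_range_succ]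
        omega
      refine ⟨?_, hsum⟩
      have h := key (n + 1)
      rw [Finset.sum_range_reflect, Nat.add_sub_cancel] at h
      omega
  induction n with
  | zero => exact Nat.zero_le _
  | succ n ih => have := (step n).1; omega

/-! ### The group generated by the involutions -/

/-- The algebra with relators `r`. -/
abbrev RelatorQuotient (r : Fin 6 ⊕ ℕ → FreeAlg) : Type :=
  (TwoSidedIdeal.span (Set.range r)).ringCon.Quotient

/-- The projection of the free algebra to the algebra with relators `r`. -/
noncomputable def quotientMap (r : Fin 6 ⊕ ℕ → FreeAlg) : FreeAlg →+* RelatorQuotient r :=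
  (TwoSidedIdeal.span (Set.range r)).ringCon.mk'

theorem quotientMap_eq_iff {r : Fin 6 ⊕ ℕ → FreeAlg} {a b : FreeAlg} :
    quotientMap r a = quotientMap r b ↔ a - b ∈ TwoSidedIdeal.span (Set.range r) := by
  rw [← TwoSidedIdeal.rel_iff]
  exact RingCon.eq _

theorem quotientMap_surjective (r : Fin 6 ⊕ ℕ → FreeAlg) : Function.Surjective (quotientMap r) :=
  RingCon.mk'_surjective _

theorem sub_mem_truncatedIdeal {r : Fin 6 ⊕ ℕ → FreeAlg} {a b : FreeAlg}
    (h : quotientMap r a = quotientMap r b) (n : ℕ) : a - b ∈ truncatedIdeal r n := by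
  rw [quotientMap_eq_iff, TwoSidedIdeal.mem_span_iff_mem_addSubgroup_closure] at h
  refine (AddSubgroup.closure_le (K := (truncatedIdeal r n).toAddSubgroup)).2 ?_ h
  rintro _ ⟨_, ⟨a, -, _, ⟨k, rfl⟩, rfl⟩, b, -, rfl⟩
  exact mul_relator_mul_mem n a k b

theorem one_add_gen_mul_self (i : Fin 6) :
    (1 + gen (ZMod 2) i) * (1 + gen (ZMod 2) i) - 1 = gen (ZMod 2) i * gen (ZMod 2) i := by
  have h : gen (ZMod 2) i + gen (ZMod 2) i = 0 := by
    rw [← two_smul (ZMod 2), show (2 : ZMod 2) = 0 from rfl, zero_smul]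
  calc _ = (gen (ZMod 2) i + gen (ZMod 2) i) + gen (ZMod 2) i * gen (ZMod 2) i := by noncomm_ring
    _ = _ := by rw [h, zero_add]

theorem span_closure_one_add_gen :
    Submodule.span (ZMod 2)
      (Submonoid.closure (Set.range fun i : Fin 6 => 1 + gen (ZMod 2) i) : Set FreeAlg) = ⊤ := by
  rw [← Algebra.adjoin_eq_span]
  refine eq_top_iff.2 fun a _ => ?_
  rw [Subalgebra.mem_toSubmodule]
  induction a using MonoidAlgebra.induction_on with
  | of w =>
    induction w using word_induction with
    | one => rw [map_one]; exact one_mem _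
    | mul_of w i hw =>
      rw [map_mul]
      refine mul_mem (hw trivial) ?_
      have h : gen (ZMod 2) i = (1 + gen (ZMod 2) i) - 1 := by abel
      change gen (ZMod 2) i ∈ _
      rw [h]
      exact sub_mem (Algebra.subset_adjoin ⟨i, rfl⟩) (one_mem _)
  | add a b ha hb => exact add_mem (ha trivial) (hb trivial)
  | smul c a ha => exact Subalgebra.smul_mem _ (ha trivial) c

section Group

variable (r : Fin 6 ⊕ ℕ → FreeAlg)
  (hsq : ∀ i, r (Sum.inl i) = gen (ZMod 2) i * gen (ZMod 2) i)

theorem quotientMap_one_add_gen_mul_self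
    (hsq : ∀ i, r (Sum.inl i) = gen (ZMod 2) i * gen (ZMod 2) i) (i : Fin 6) :
    quotientMap r (1 + gen (ZMod 2) i) * quotientMap r (1 + gen (ZMod 2) i) = 1 := by
  rw [← map_mul, ← map_one (quotientMap r), quotientMap_eq_iff, one_add_gen_mul_self, ← hsq]
  exact TwoSidedIdeal.subset_span ⟨_, rfl⟩

/-- The involution `1 + x i` in the algebra with relators `r`. -/
noncomputable def involution (i : Fin 6) : (RelatorQuotient r)ˣ where
  val := quotientMap r (1 + gen (ZMod 2) i)
  inv := quotientMap r (1 + gen (ZMod 2) i)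
  val_inv := quotientMap_one_add_gen_mul_self r hsq i
  inv_val := quotientMap_one_add_gen_mul_self r hsq i

/-- The group generated by the involutions `1 + x i`. -/
noncomputable def involutionGroup : Subgroup (RelatorQuotient r)ˣ :=
  Subgroup.closure (Set.range (involution r hsq))

/-- Products of the `1 + x i` span the free algebra, so a finite group would bound the dimension of
every truncation by its order. -/
theorem infinite_involutionGroup
    (hr : ∀ k, r k ∈ wordFiltration (ZMod 2) (Fin 6) (relatorDeg k)) :
    Infinite (involutionGroup r hsq) := by
  by_contra hfin
  rw [not_infinite_iff_finite] at hfin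
  have := Fintype.ofFinite (involutionGroup r hsq)
  choose f hf using fun g : involutionGroup r hsq =>
    quotientMap_surjective r ((g : (RelatorQuotient r)ˣ) : RelatorQuotient r)
  have hlift : ∀ a ∈ Submonoid.closure (Set.range fun i : Fin 6 => 1 + gen (ZMod 2) i),
      ∃ g : involutionGroup r hsq,
        quotientMap r a = ((g : (RelatorQuotient r)ˣ) : RelatorQuotient r) := by
    intro a ha
    induction ha using Submonoid.closure_induction with
    | mem a ha =>
      obtain ⟨i, rfl⟩ := ha
      exact ⟨⟨involution r hsq i, Subgroup.subset_closure ⟨i, rfl⟩⟩, rfl⟩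
    | one => exact ⟨1, map_one _⟩
    | mul a b _ _ ha hb =>
      obtain ⟨g, hg⟩ := ha
      obtain ⟨h, hh⟩ := hb
      exact ⟨g * h, by rw [map_mul, hg, hh]; rfl⟩
  have hbound : ∀ n, truncDim r n ≤ Fintype.card (involutionGroup r hsq) := by
    intro n
    have hspan :
        Submodule.span (ZMod 2) (Set.range fun g => (truncatedIdeal r n).mkQ (f g)) = ⊤ := by
      have h := congrArg (Submodule.map (truncatedIdeal r n).mkQ) span_closure_one_add_gen
      rw [Submodule.map_top, Submodule.range_mkQ, Submodule.map_span] at h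
      rw [eq_top_iff, ← h]
      refine Submodule.span_mono ?_
      rintro _ ⟨a, ha, rfl⟩
      obtain ⟨g, hg⟩ := hlift a ha
      refine ⟨g, (Submodule.Quotient.eq _).2 (sub_mem_truncatedIdeal ?_ n)⟩
      rw [hf, hg]
    have h := finrank_range_le_card (R := ZMod 2) fun g => (truncatedIdeal r n).mkQ (f g)
    rwa [Set.finrank, hspan, finrank_top] at h
  have h1 := le_truncDim hr (Fintype.card (involutionGroup r hsq) + 1)
  have h2 := hbound (Fintype.card (involutionGroup r hsq) + 1)
  omega

/-- The tape graph of the group generated by the involutions `1 + x i`. -/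
noncomputable def involutionTapeGraph
    (hr : ∀ k, r k ∈ wordFiltration (ZMod 2) (Fin 6) (relatorDeg k)) :
    TapeGraph (involutionGroup r hsq) where
  gens := Subtype.val ⁻¹' Set.range (involution r hsq)
  infinite := infinite_involutionGroup r hsq hr
  finite_gens := (Set.finite_range _).preimage Subtype.val_injective.injOn
  inv_mem := by
    rintro ⟨_, hg⟩ ⟨i, rfl⟩
    -- Each `involution` has equal `val` and `inv`, so it is its own inverse by definition.
    exact ⟨i, rfl⟩
  closure_gens := Subgroup.closure_closure_coe_preimage

theorem coe_path
    (hr : ∀ k, r k ∈ wordFiltration (ZMod 2) (Fin 6) (relatorDeg k))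
    (s : ℕ → (involutionTapeGraph r hsq hr).gens) (t : ℕ → Fin 6)
    (hst : ∀ k, ((s k : involutionGroup r hsq) : (RelatorQuotient r)ˣ) = involution r hsq (t k))
    (k : ℕ) :
    ((((involutionTapeGraph r hsq hr).path s k : involutionGroup r hsq) :
      (RelatorQuotient r)ˣ) : RelatorQuotient r) = quotientMap r (prefixProd t k) := by
  induction k with
  | zero => simp [TapeGraph.path, prefixProd]
  | succ k ih =>
    rw [prefixProd_succ, map_mul, ← ih, TapeGraph.path, Subgroup.coe_mul, Units.val_mul, hst]
    rfl

end Group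

/-! ### Enumeration of the computable sequences -/

theorem countable_setOf_computable (n : ℕ) : {f : ℕ → Fin n | Computable f}.Countable := by
  have : Function.Injective fun f : {f : ℕ → Fin n | Computable f} =>
      (⟨fun k => (f.1 k : ℕ), (Primrec.fin_val).to_comp.comp f.2⟩ :
        {f : ℕ → ℕ // Computable f}) := by
    intro f g h
    ext k
    exact congrFun (congrArg Subtype.val h) k
  exact Set.countable_coe_iff.1 this.countable

/-- The sequences obtained from a computable sequence in some `Fin n` by relabelling. -/
def relabelledComputable (A : Type*) : Set (ℕ → A) :=
  ⋃ n : ℕ, ⋃ g : Fin n → A, (fun f => g ∘ f) '' {f : ℕ → Fin n | Computable f}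

theorem countable_relabelledComputable (A : Type*) [Countable A] :
    (relabelledComputable A).Countable :=
  Set.countable_iUnion fun n => Set.countable_iUnion fun _ =>
    (countable_setOf_computable n).image _

/-- The generators exist only after the relators are chosen, so the enumeration is made beforehand
over `Fin 6`; this transfers a sequence of generators to it. -/
theorem comp_mem_relabelledComputable {A B : Type*} {s : ℕ → A} (hs : IsComputableSeq s)
    (g : A → B) : g ∘ s ∈ relabelledComputable B := by
  obtain ⟨n, e, he⟩ := hs
  refine Set.mem_iUnion.2 ⟨n, Set.mem_iUnion.2 ⟨g ∘ e.symm, _, he, ?_⟩⟩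
  ext k
  simp

end GolodShafarevich

open GolodShafarevich

theorem mainTheorem1 :
    ∃ (G : Type) (_ : Group G) (T : TapeGraph G), T.IsInescapable := by
  obtain ⟨seq, hseq⟩ :=
    Set.countable_iff_exists_subset_range.1 (countable_relabelledComputable (Fin 6))
  choose a b hab hmem using fun k : ℕ => exists_prefixProd_sub_mem (seq k) (k + 2)
  obtain ⟨r, hsq, hseqr⟩ : ∃ r : Fin 6 ⊕ ℕ → FreeAlg,
      (∀ i, r (Sum.inl i) = gen (ZMod 2) i * gen (ZMod 2) i) ∧
      ∀ k, r (Sum.inr k) = prefixProd (seq k) (b k) - prefixProd (seq k) (a k) :=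
    ⟨Sum.elim _ _, fun _ => rfl, fun _ => rfl⟩
  have hr : ∀ k, r k ∈ wordFiltration (ZMod 2) (Fin 6) (relatorDeg k) := by
    rintro (i | k)
    · rw [hsq, show relatorDeg (Sum.inl i) = 1 + 1 from rfl]
      exact mul_mem_wordFiltration (gen_mem_wordFiltration i) (gen_mem_wordFiltration i)
    · rw [hseqr, show relatorDeg (Sum.inr k) = k + 2 from rfl]
      exact hmem k
  refine ⟨involutionGroup r hsq, inferInstance, involutionTapeGraph r hsq hr, fun s hs => ?_⟩
  -- Distinct indices might give the same involution; any choice of index serves.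
  choose label hlabel using fun g : (involutionTapeGraph r hsq hr).gens => g.2
  obtain ⟨k, hk⟩ := hseq (comp_mem_relabelledComputable hs label)
  refine ⟨a k, b k, hab k, ?_⟩
  refine Subtype.ext (Units.ext ?_)
  have hpath := coe_path r hsq hr s (label ∘ s) fun j => (hlabel (s j)).symm
  rw [hpath, hpath, ← hk, eq_comm, quotientMap_eq_iff, ← hseqr]
  exact TwoSidedIdeal.subset_span ⟨Sum.inr k, rfl⟩
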